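/- Let $V$ be a finite set, let $\mathcal G=(V,E)$ be a directed acyclic graph (DAG), and let $T\subseteq E$ be a set of target edges. Two DAGs on $V$ are Markov equivalent if the same positive joint distributions $P$ of random variables indexed by $V$ (with finite state spaces) factorize according to them, i.e. satisfy $P(x)=\prod_{v\in V}P(x_v\mid x_{\mathrm{Pa}(v)})$. An intervention is a set $I\subseteq V$; it is atomic if $|I|=1$. For a set $\mathcal I\subseteq 2^V$ of interventions, the $\mathcal I$-essential graph $\mathcal E_{\mathcal I}(\mathcal G)$ is the partially oriented graph representing all DAGs that are Markov equivalent to $\mathcal G$ and orient every arc between $I$ and $V\setminus I$ as $\mathcal G$ does, for every $I\in\mathcal I$: an edge is oriented as $u\to v$ if $u\to v$ in all these DAGs, and it is undirected if two of these DAGs orient it in opposite ways. Let $R(\mathcal G,\mathcal I)$ be the set of oriented arcs of $\mathcal E_{\mathcal I}(\mathcal G)$, and let $CC(\mathcal E_{\mathcal I}(\mathcal G))$ be the set of its chain components, i.e. of the connected components of the undirected graph on $V$ that is left after all oriented arcs are removed. For a chain component $\mathcal H$ let $E(\mathcal H)$ be its set of edges. Let $\nu_1(\mathcal G,T)$ be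 the minimum size $|\mathcal J|$ of a set $\mathcal J$ of atomic interventions with $T\subseteq R(\mathcal G,\mathcal J)$. Then $$\nu_1(\mathcal G,T)\;\ge\;\max_{\mathcal I\subseteq 2^V}\;\sum_{\mathcal H\in CC(\mathcal E_{\mathcal I}(\mathcal G))}\mathbf 1\big(E(\mathcal H)\cap T\neq\varnothing\big).$$ In particular the bound holds with the maximum taken only over single interventions $\mathcal I=\{I\}$, $I\subseteq V$, or only over sets of atomic interventions $\mathcal I=\{\{v\}:v\in I\}$, $I\subseteq V$. -/

import Mathlib

namespace CausalDAG

/-- A directed acyclic graph on the vertex set `V`: `G.Adj u v` means `u → v`, and no vertex can be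
reached from itself along one or more arcs. -/
structure DAG (V : Type*) extends Digraph V where
  acyclic : ∀ v, ¬ Relation.TransGen Adj v v

/-- A partially oriented graph: oriented arcs together with undirected edges. -/
structure PartiallyOrientedGraph (V : Type*) where
  /-- `arc u v` : the edge between `u` and `v` is oriented as `u → v`. -/
  arc : V → V → Prop
  /-- The unoriented edges. -/
  undirected : SimpleGraph V

section Distributions

variable {V : Type*} [Fintype V] [DecidableEq V] {S : V → Type} [∀ v, Fintype (S v)]

/-- `p` is the probability mass function of a positive joint distribution of random variables
indexed by `V`, the variable `v` taking its values in the finite set `S v`. -/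
def IsPositiveDistribution (p : (∀ v, S v) → ℝ) : Prop :=
  (∀ x, 0 < p x) ∧ ∑ x, p x = 1

open Classical in
/-- The marginal probability that the variables in `A` take the values prescribed by `x`. -/
noncomputable def marginal (p : (∀ v, S v) → ℝ) (A : Set V) (x : ∀ v, S v) : ℝ :=
  ∑ y with ∀ w ∈ A, y w = x w, p y

/-- The conditional probability `P(x_v ∣ x_A)`. -/
noncomputable def conditional (p : (∀ v, S v) → ℝ) (v : V) (A : Set V) (x : ∀ v, S v) : ℝ :=
  marginal p (insert v A) x / marginal p A x

/-- The set of parents of `v` in `G`. -/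
def DAG.parents {V : Type*} (G : DAG V) (v : V) : Set V := {u | G.Adj u v}

/-- `P` factorizes according to `G`: `P(x) = ∏ v, P(x_v ∣ x_{Pa(v)})`. -/
def Factorizes (G : DAG V) (p : (∀ v, S v) → ℝ) : Prop :=
  ∀ x, p x = ∏ v, conditional p v (G.parents v) x

end Distributions

section EssentialGraphs

variable {V : Type*} [Fintype V] [DecidableEq V]

/-- Markov equivalence: the same positive distributions factorize according to `G` and `H`. -/
def MarkovEquivalent (G H : DAG V) : Prop :=
  ∀ (S : V → Type) [∀ v, Fintype (S v)] (p : (∀ v, S v) → ℝ),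
    IsPositiveDistribution p → (Factorizes G p ↔ Factorizes H p)

/-- The Markov equivalence class of `G`. -/
def markovClass (G : DAG V) : Set (DAG V) := {H | MarkovEquivalent G H}

/-- The edge between `u` and `v` is cut by `I` and its complement. -/
def IsCut (I : Finset V) (u v : V) : Prop :=
  (u ∈ I ∧ v ∉ I) ∨ (u ∉ I ∧ v ∈ I)

/-- The DAGs Markov equivalent to `G` in which, for every intervention `I ∈ 𝓘`, the arcs cut by `I`
and its complement are oriented as in `G`. -/
def interventionalClass (G : DAG V) (𝓘 : Finset (Finset V)) : Set (DAG V) :=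
  {H | H ∈ markovClass G ∧ ∀ I ∈ 𝓘, ∀ u v, IsCut I u v → (H.Adj u v ↔ G.Adj u v)}

/-- The graph representing a class of DAGs: an arc is oriented if it occurs in every member, and an
edge is undirected if two members orient it in opposite ways. -/
def representingGraph (C : Set (DAG V)) : PartiallyOrientedGraph V where
  arc u v := ∀ H ∈ C, H.Adj u v
  undirected :=
    { Adj := fun u v => ∃ H₁ ∈ C, ∃ H₂ ∈ C, H₁.Adj u v ∧ H₂.Adj v u
      symm := ⟨fun _ _ ⟨H₁, h₁, H₂, h₂, a, b⟩ => ⟨H₂, h₂, H₁, h₁, b, a⟩⟩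
      loopless := ⟨fun v ⟨H₁, _, _, _, a, _⟩ => H₁.acyclic v (Relation.TransGen.single a)⟩ }

/-- The `𝓘`-essential graph of `G`. -/
def essentialGraph (G : DAG V) (𝓘 : Finset (Finset V)) : PartiallyOrientedGraph V :=
  representingGraph (interventionalClass G 𝓘)

/-- The set of arcs of `G`. -/
def DAG.arcs {V : Type*} (G : DAG V) : Set (V × V) := {a | G.Adj a.1 a.2}

/-- The set `R(G, 𝓘)` of oriented arcs of the `𝓘`-essential graph of `G`. -/
def orientedArcs (G : DAG V) (𝓘 : Finset (Finset V)) : Set (V × V) :=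
  {a | (essentialGraph G 𝓘).arc a.1 a.2}

/-- Chain components: the connected components that are left when all arcs are removed. -/
abbrev ChainComponent {V : Type*} (P : PartiallyOrientedGraph V) :=
  P.undirected.ConnectedComponent

/-- The edges of a chain component. -/
def ChainComponent.edges {V : Type*} {P : PartiallyOrientedGraph V} (H : ChainComponent P) :
    Set (Sym2 V) :=
  {e | e ∈ P.undirected.edgeSet ∧ ∀ w ∈ e, w ∈ H.supp}

/-- The number of chain components that contain at least one edge of `T`. -/
noncomputable def numTargetComponents {V : Type*} (P : PartiallyOrientedGraph V)
    (T : Set (V × V)) : ℕ :=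
  Set.ncard {H : ChainComponent P | (ChainComponent.edges H ∩ {e | ∃ a ∈ T, e = s(a.1, a.2)}).Nonempty}

/-- `𝓘` is a subset verifying set for the target edges `T` in `G`: all of `T` is oriented in the
`𝓘`-essential graph. -/
def IsSubsetVerifying (G : DAG V) (T : Set (V × V)) (𝓘 : Finset (Finset V)) : Prop :=
  T ⊆ orientedArcs G 𝓘

/-- All interventions in `𝓘` are atomic. -/
def IsAtomic (𝓘 : Finset (Finset V)) : Prop := ∀ I ∈ 𝓘, I.card = 1

/-- For target edges of `G` an atomic subset verifying set exists, so that the minimum below is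
taken over a nonempty set. -/
theorem exists_atomic_isSubsetVerifying (G : DAG V) (T : Set (V × V)) (hT : T ⊆ G.arcs) :
    ∃ 𝓘 : Finset (Finset V), IsAtomic 𝓘 ∧ IsSubsetVerifying G T 𝓘 := by
  refine ⟨Finset.univ.image (fun v => {v}), ?_, ?_⟩
  · intro I hI
    obtain ⟨v, -, rfl⟩ := Finset.mem_image.1 hI
    simp
  · rintro ⟨u, v⟩ ha H ⟨-, hH⟩
    have huv : G.Adj u v := hT ha
    refine (hH {u} (by simp) u v (Or.inl ⟨by simp, ?_⟩)).2 huv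
    intro h
    rw [Finset.mem_singleton] at h
    subst h
    exact G.acyclic _ (Relation.TransGen.single huv)

/-- The minimum verification number `ν₁(G, T)`: the minimum size of a subset verifying set for `T`
in `G` that consists of atomic interventions. -/
noncomputable def nuOne (G : DAG V) (T : Set (V × V)) : ℕ :=
  sInf {n | ∃ 𝓘 : Finset (Finset V), IsAtomic 𝓘 ∧ IsSubsetVerifying G T 𝓘 ∧ 𝓘.card = n}

end EssentialGraphs

end CausalDAG

/-! Call a set terminal if one of its vertices receives arcs from all its others. DAGs are Markov
equivalent exactly when they have the same terminal sets (`markovEquivalent_iff_hasTerminal`); this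
replaces the criterion by skeleton and v-structures. Let `K` be a chain component containing a
target edge, and let `D` be a member of the `𝓘`-class that reverses that target arc. As `G` is also
a member, `D` and `G` differ only on edges within chain components. Hence taking `D` inside `K` and
`G` elsewhere keeps the terminal sets, and an asymmetric relation with the terminal sets of a DAG is
acyclic. The spliced DAG is thus Markov equivalent to `G`. If no atomic intervention of a verifying
set `𝓙` lay in `K`, the splice would respect every cut of `𝓙` and yet reverse a target arc. So `𝓙`
meets each such component, and components are disjoint. -/

namespace CausalDAG

open Relation

variable {V : Type*}

/-! ### Terminal sets and acyclicity -/

/-- `C` contains a vertex that has all other vertices of `C` as predecessors. -/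
def HasTerminal (R : V → V → Prop) (C : Finset V) : Prop :=
  ∃ w ∈ C, ∀ u ∈ C, u ≠ w → R u w

theorem DAG.irrefl (G : DAG V) (v : V) : ¬ G.Adj v v :=
  fun h => G.acyclic v (TransGen.single h)

theorem DAG.asymm (G : DAG V) {u v : V} (h : G.Adj u v) : ¬ G.Adj v u :=
  fun h' => G.acyclic u ((TransGen.single h).tail h')

theorem terminal_unique {R : V → V → Prop} (hR : ∀ u v, R u v → ¬ R v u) {C : Finset V} {v w : V}
    (hv : v ∈ C) (hv' : ∀ u ∈ C, u ≠ v → R u v) (hw : w ∈ C) (hw' : ∀ u ∈ C, u ≠ w → R u w) :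
    v = w := by
  by_contra h
  exact hR _ _ (hw' v hv h) (hv' w hw (Ne.symm h))

/-- Equal terminal sets therefore force equal skeletons. -/
theorem hasTerminal_pair_iff [DecidableEq V] {R : V → V → Prop} {u v : V} (huv : u ≠ v) :
    HasTerminal R {u, v} ↔ R u v ∨ R v u := by
  simp only [HasTerminal, Finset.mem_insert, Finset.mem_singleton]
  constructor
  · rintro ⟨w, rfl | rfl, h⟩
    · exact Or.inr (h v (Or.inr rfl) huv.symm)
    · exact Or.inl (h u (Or.inl rfl) huv)
  · rintro (h | h)
    · refine ⟨v, Or.inr rfl, ?_⟩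
      rintro x (rfl | rfl) hx
      exacts [h, absurd rfl hx]
    · refine ⟨u, Or.inl rfl, ?_⟩
      rintro x (rfl | rfl) hx
      exacts [absurd rfl hx, h]

open Classical in
/-- An asymmetric relation with the same terminal sets as a DAG shortcuts the vertices that are
sinks of the DAG. -/
theorem shortcut_of_hasTerminal_iff {R : V → V → Prop} (hR : ∀ u v, R u v → ¬ R v u) (G : DAG V)
    (h : ∀ C, HasTerminal R C ↔ HasTerminal G.Adj C) {a s b : V} (hsa : ¬ G.Adj s a)
    (hsb : ¬ G.Adj s b) (has : R a s) (hs : R s b) : R a b := by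
  have nas : a ≠ s := fun e => hR _ _ has (by subst e; exact has)
  have nsb : s ≠ b := fun e => hR _ _ hs (by subst e; exact hs)
  have gas : G.Adj a s :=
    ((hasTerminal_pair_iff nas).1 ((h _).1 ((hasTerminal_pair_iff nas).2 (Or.inl has)))).resolve_right
      hsa
  have gbs : G.Adj b s :=
    ((hasTerminal_pair_iff nsb).1 ((h _).1 ((hasTerminal_pair_iff nsb).2 (Or.inl hs)))).resolve_left
      hsb
  have nab : a ≠ b := fun e => hR _ _ has (by subst e; exact hs)
  -- In `G` both `a` and `b` point to `s`, so the triple is terminal. For `R`, the arcs `a → s → b`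
  -- rule out `a` and `s` as its terminal vertex, which leaves `b`.
  obtain ⟨w, hw, hw'⟩ : HasTerminal R {a, s, b} := by
    refine (h _).2 ⟨s, by simp, ?_⟩
    intro u hu hus
    simp only [Finset.mem_insert, Finset.mem_singleton] at hu
    rcases hu with rfl | rfl | rfl
    exacts [gas, absurd rfl hus, gbs]
  simp only [Finset.mem_insert, Finset.mem_singleton] at hw
  rcases hw with rfl | rfl | rfl
  · exact absurd (hw' s (by simp) nas.symm) (hR _ _ has)
  · exact absurd (hw' b (by simp) nsb.symm) (hR _ _ hs)
  · exact hw' a (by simp) nab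

theorem exists_sink (G : DAG V) [Finite V] {S : Finset V} (hS : S.Nonempty) :
    ∃ s ∈ S, ∀ t ∈ S, ¬ G.Adj s t := by
  let r : V → V → Prop := fun a b => TransGen G.Adj b a
  have : IsTrans V r := ⟨fun _ _ _ h₁ h₂ => h₂.trans h₁⟩
  have : Std.Irrefl r := ⟨fun a h => G.acyclic a h⟩
  obtain ⟨s, hs, hmin⟩ := (Finite.wellFounded_of_trans_of_irrefl r).has_min (S : Set V) hS
  exact ⟨s, hs, fun t ht hst => hmin t ht (TransGen.single hst)⟩

/-- An asymmetric relation with the same terminal sets as a DAG is acyclic. -/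
theorem acyclic_of_hasTerminal_iff [Fintype V] [DecidableEq V] {R : V → V → Prop}
    (hR : ∀ u v, R u v → ¬ R v u) (G : DAG V)
    (h : ∀ C, HasTerminal R C ↔ HasTerminal G.Adj C) (v : V) : ¬ TransGen R v v := by
  -- Induction on the vertex set carrying the cycle: a `G`-sink `s` of `S` can be cut out of any
  -- `R`-cycle by shortcuts.
  have key : ∀ S : Finset V, ∀ v, ¬ TransGen (fun x y => R x y ∧ x ∈ S ∧ y ∈ S) v v := by
    intro S
    induction S using Finset.strongInduction with
    | H S ih =>
    intro v hv
    have hS : S.Nonempty := by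
      obtain ⟨b, hb, -⟩ := TransGen.head'_iff.1 hv
      exact ⟨v, hb.2.1⟩
    obtain ⟨s, hs, hsink⟩ := exists_sink G hS
    set R' : V → V → Prop := fun x y => R x y ∧ x ∈ S.erase s ∧ y ∈ S.erase s
    -- A walk currently ending at `s` is remembered by its last vertex `a` before `s`, so that the
    -- next arc `s → z` can be replaced by `a → z`.
    have bypass : ∀ x y, x ≠ s → TransGen (fun x y => R x y ∧ x ∈ S ∧ y ∈ S) x y →
        (y ≠ s → TransGen R' x y) ∧
          (y = s → ∃ a ∈ S, a ≠ s ∧ R a s ∧ ReflTransGen R' x a) := by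
      intro x y hx hxy
      induction hxy with
      | single hxy =>
        refine ⟨fun hy => TransGen.single ⟨hxy.1, Finset.mem_erase.2 ⟨hx, hxy.2.1⟩,
          Finset.mem_erase.2 ⟨hy, hxy.2.2⟩⟩, ?_⟩
        rintro rfl
        exact ⟨x, hxy.2.1, hx, hxy.1, ReflTransGen.refl⟩
      | @tail y z _ hyz ih' =>
        by_cases hy : y = s
        · obtain ⟨a, haS, has, hRas, hxa⟩ := ih'.2 hy
          subst hy
          have hz : z ≠ y := by
            rintro rfl
            exact hR _ _ hyz.1 hyz.1
          refine ⟨fun _ => ?_, fun e => absurd e hz⟩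
          have haz : R a z := shortcut_of_hasTerminal_iff hR G h (hsink a haS) (hsink z hyz.2.2)
            hRas hyz.1
          exact TransGen.tail' hxa ⟨haz, Finset.mem_erase.2 ⟨has, haS⟩,
            Finset.mem_erase.2 ⟨hz, hyz.2.2⟩⟩
        · refine ⟨fun hz => (ih'.1 hy).tail ⟨hyz.1, Finset.mem_erase.2 ⟨hy, hyz.2.1⟩,
            Finset.mem_erase.2 ⟨hz, hyz.2.2⟩⟩, ?_⟩
          rintro rfl
          exact ⟨y, hyz.2.1, hy, hyz.1, (ih'.1 hy).to_reflTransGen⟩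
    have cyc : ∀ b, b ≠ s → ¬ TransGen (fun x y => R x y ∧ x ∈ S ∧ y ∈ S) b b := fun b hb hbb =>
      ih _ (Finset.erase_ssubset hs) b ((bypass b b hb hbb).1 hb)
    -- A cycle based at `s` is rotated to start at the successor of `s`.
    by_cases hvs : v = s
    · obtain ⟨b, hvb, hbv⟩ := TransGen.head'_iff.1 hv
      refine cyc b ?_ (TransGen.tail' hbv hvb)
      rintro rfl
      subst hvs
      exact hR _ _ hvb.1 hvb.1
    · exact cyc v hvs hv
  intro hv
  refine key Finset.univ v ?_
  simpa using hv

/-! ### Splicing two DAGs along a vertex set -/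

section Splice

variable (G D : DAG V) (K : Set V)

/-- The relation that orients the edges inside `K` as `D` does and all other edges as `G` does. -/
def spliceAdj (u v : V) : Prop := (u ∈ K ∧ v ∈ K ∧ D.Adj u v) ∨ (¬ (u ∈ K ∧ v ∈ K) ∧ G.Adj u v)

variable {G D K}

theorem spliceAdj_of_notMem {u v : V} (h : ¬ (u ∈ K ∧ v ∈ K)) :
    spliceAdj G D K u v ↔ G.Adj u v := by
  unfold spliceAdj; tauto

/-- Agreement on the boundary of `K` lets `D` describe every edge that touches `K`, not only those
inside. -/
theorem spliceAdj_of_mem (hK : ∀ u v, ¬ (u ∈ K ↔ v ∈ K) → (D.Adj u v ↔ G.Adj u v)) {u v : V}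
    (h : u ∈ K ∨ v ∈ K) : spliceAdj G D K u v ↔ D.Adj u v := by
  have := hK u v
  unfold spliceAdj; tauto

theorem spliceAdj_asymm (hK : ∀ u v, ¬ (u ∈ K ↔ v ∈ K) → (D.Adj u v ↔ G.Adj u v)) (u v : V)
    (h : spliceAdj G D K u v) : ¬ spliceAdj G D K v u := by
  by_cases huv : u ∈ K ∧ v ∈ K
  · rw [spliceAdj_of_mem hK (Or.inl huv.1)] at h
    rw [spliceAdj_of_mem hK (Or.inl huv.2)]
    exact D.asymm h
  · rw [spliceAdj_of_notMem huv] at h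
    rw [spliceAdj_of_notMem (fun h => huv h.symm)]
    exact G.asymm h

/-- The arcs entering a given vertex all come from `D` if it lies in `K`, and all from `G`
otherwise. The only obstruction is a set whose `G`-terminal vertex is in `K` and whose `D`-terminal
vertex is outside; the edge joining these two would then be a boundary edge on which `D` and `G`
disagree. -/
theorem hasTerminal_spliceAdj_iff (hK : ∀ u v, ¬ (u ∈ K ↔ v ∈ K) → (D.Adj u v ↔ G.Adj u v))
    (h : ∀ C, HasTerminal D.Adj C ↔ HasTerminal G.Adj C) (C : Finset V) :
    HasTerminal (spliceAdj G D K) C ↔ HasTerminal G.Adj C := by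
  constructor
  · rintro ⟨w, hw, hw'⟩
    by_cases hwK : w ∈ K
    · exact (h C).1 ⟨w, hw, fun u hu huw => (spliceAdj_of_mem hK (Or.inr hwK)).1 (hw' u hu huw)⟩
    · exact ⟨w, hw, fun u hu huw =>
        (spliceAdj_of_notMem (fun h => hwK h.2)).1 (hw' u hu huw)⟩
  · intro hG
    obtain ⟨w, hw, hw'⟩ := (h C).2 hG
    obtain ⟨z, hz, hz'⟩ := hG
    by_cases hzK : z ∈ K
    · by_cases hwK : w ∈ K
      · exact ⟨w, hw, fun u hu huw => (spliceAdj_of_mem hK (Or.inr hwK)).2 (hw' u hu huw)⟩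
      · have hzw : z ≠ w := fun e => hwK (e ▸ hzK)
        have h₁ : G.Adj z w := (hK z w (by tauto)).1 (hw' z hz hzw)
        exact absurd (hz' w hw hzw.symm) (G.asymm h₁)
    · exact ⟨z, hz, fun u hu huz =>
        (spliceAdj_of_notMem (fun h => hzK h.2)).2 (hz' u hu huz)⟩

/-- The DAG that orients the edges inside `K` as `D` does and all other edges as `G` does. -/
def splice [Fintype V] [DecidableEq V] (hK : ∀ u v, ¬ (u ∈ K ↔ v ∈ K) → (D.Adj u v ↔ G.Adj u v))
    (h : ∀ C, HasTerminal D.Adj C ↔ HasTerminal G.Adj C) : DAG V where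
  Adj := spliceAdj G D K
  acyclic := acyclic_of_hasTerminal_iff (spliceAdj_asymm hK) G (hasTerminal_spliceAdj_iff hK h)

end Splice

/-! ### Each terminal set is counted at exactly one vertex -/

section Terminal

open Classical in
theorem prod_ite_terminal {M : Type*} [CommMonoid M] [Fintype V] (G : DAG V) (C : Finset V)
    (m : M) :
    ∏ v, (if v ∈ C ∧ ∀ u ∈ C, u ≠ v → G.Adj u v then m else 1) =
      if HasTerminal G.Adj C then m else 1 := by
  by_cases h : HasTerminal G.Adj C
  · obtain ⟨w, hw, hw'⟩ := h
    rw [if_pos ⟨w, hw, hw'⟩, Finset.prod_eq_single w, if_pos ⟨hw, hw'⟩]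
    · intro v _ hv
      exact if_neg fun ⟨h₁, h₂⟩ => hv (terminal_unique (R := G.Adj) (fun _ _ => G.asymm) h₁ h₂ hw hw')
    · simp
  · rw [if_neg h]
    exact Finset.prod_eq_one fun v _ => if_neg fun ⟨h₁, h₂⟩ => h ⟨v, h₁, h₂⟩

theorem coe_subset_insert_iff (C : Finset V) (A : Set V) (v : V) :
    (C : Set V) ⊆ insert v A ↔ (C : Set V) ⊆ A ∨ (v ∈ C ∧ ∀ u ∈ C, u ≠ v → u ∈ A) := by
  constructor
  · intro h
    by_cases hvC : v ∈ C
    · exact Or.inr ⟨hvC, fun u hu huv => (h hu).resolve_left huv⟩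
    · exact Or.inl fun u hu => (h hu).resolve_left fun e => hvC (e ▸ hu)
  · rintro (h | ⟨-, h⟩) u hu
    · exact Or.inr (h hu)
    · by_cases huv : u = v
      exacts [Or.inl huv, Or.inr (h u hu huv)]

end Terminal

/-! ### Möbius inversion: sums over families depend only on terminal sets -/

section Moebius

theorem exists_eq_sum_powerset [DecidableEq V] (f : Finset V → ℝ) :
    ∃ g : Finset V → ℝ, ∀ A, f A = ∑ C ∈ A.powerset, g C := by
  let g : Finset V → ℝ := Finset.strongInduction
    fun A rec => f A - ∑ C ∈ A.ssubsets.attach, rec C.1 (Finset.mem_ssubsets.1 C.2)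
  refine ⟨g, fun A => ?_⟩
  have hg : g A = f A - ∑ C ∈ A.ssubsets, g C := by
    rw [← Finset.sum_attach A.ssubsets]
    exact Finset.strongInduction_eq _ A
  rw [← Finset.sum_erase_add _ _ (Finset.mem_powerset_self A)]
  change f A = ∑ C ∈ A.ssubsets, g C + g A
  rw [hg]
  ring

-- Expand `F` as a sum of `g C` over the subsets `C` of its argument. The increment at `v` collects
-- the `C` whose terminal vertex is `v`, so the total is the sum of `g` over all terminal sets.
open Classical in
theorem sum_sub_eq_of_hasTerminal_iff [Fintype V] (F : Set V → ℝ) {G H : DAG V}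
    (h : ∀ C, HasTerminal G.Adj C ↔ HasTerminal H.Adj C) :
    ∑ v, (F (insert v (G.parents v)) - F (G.parents v)) =
      ∑ v, (F (insert v (H.parents v)) - F (H.parents v)) := by
  obtain ⟨g, hg⟩ := exists_eq_sum_powerset fun A : Finset V => F A
  have hF : ∀ A : Set V, F A = ∑ C : Finset V, if (C : Set V) ⊆ A then g C else 0 := by
    intro A
    have := hg A.toFinset
    rw [Set.coe_toFinset] at this
    rw [this, ← Finset.sum_filter]
    refine Finset.sum_congr ?_ fun _ _ => rfl
    ext C
    simp [Finset.mem_powerset, Set.subset_toFinset]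
  have main : ∀ G : DAG V, ∑ v, (F (insert v (G.parents v)) - F (G.parents v)) =
      ∑ C : Finset V, if HasTerminal G.Adj C then g C else 0 := by
    intro G
    have step : ∀ v, F (insert v (G.parents v)) - F (G.parents v) =
        ∑ C : Finset V, if v ∈ C ∧ ∀ u ∈ C, u ≠ v → G.Adj u v then g C else 0 := by
      intro v
      have hv : v ∉ G.parents v := G.irrefl v
      rw [hF, hF, ← Finset.sum_sub_distrib]
      refine Finset.sum_congr rfl fun C _ => ?_
      have h₁ := coe_subset_insert_iff C (G.parents v) v
      have h₂ : ¬ ((C : Set V) ⊆ G.parents v ∧ v ∈ C) := fun h => hv (h.1 h.2)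
      change _ = if v ∈ C ∧ ∀ u ∈ C, u ≠ v → u ∈ G.parents v then g C else 0
      by_cases hA : (C : Set V) ⊆ G.parents v
      · rw [if_pos (h₁.2 (Or.inl hA)), if_pos hA, if_neg (fun h => h₂ ⟨hA, h.1⟩), sub_self]
      · rw [if_neg hA, sub_zero]
        exact if_congr (h₁.trans (or_iff_right hA)) rfl rfl
    rw [Finset.sum_congr rfl fun v _ => step v, Finset.sum_comm]
    refine Finset.sum_congr rfl fun C _ => ?_
    -- A sum in `ℝ` is, by definition, a product in `Multiplicative ℝ`.
    exact prod_ite_terminal (M := Multiplicative ℝ) G C (Multiplicative.ofAdd (g C))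
  rw [main, main]
  exact Finset.sum_congr rfl fun C _ => if_congr (h C) rfl rfl

end Moebius

/-! ### Fair coins with one parity interaction -/

section Coins

/-- The sign `±1` encoded by a truth value. -/
def boolSign (b : Bool) : ℝ := if b then 1 else -1

theorem prod_boolSign (C : Finset V) (x : V → Bool) :
    ∏ w ∈ C, boolSign (x w) = 1 ∨ ∏ w ∈ C, boolSign (x w) = -1 := by
  classical
  induction C using Finset.induction_on with
  | empty => simp
  | insert a C ha ih =>
    rw [Finset.prod_insert ha]
    rcases ih with h | h <;> rw [h] <;> cases x a <;> simp [boolSign]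

open Classical in
/-- The density relative to fair coins of the marginal of `parityDist C` on `A`. -/
noncomputable def parityDensity (C : Finset V) (A : Set V) (x : V → Bool) : ℝ :=
  if (C : Set V) ⊆ A then 1 + 1 / 2 * ∏ w ∈ C, boolSign (x w) else 1

theorem parityDensity_pos (C : Finset V) (A : Set V) (x : V → Bool) :
    0 < parityDensity C A x := by
  unfold parityDensity
  split_ifs
  · rcases prod_boolSign C x with h | h <;> rw [h] <;> norm_num
  · norm_num

variable [Fintype V]

open Classical in
/-- The probability that fair coins indexed by `A` take prescribed values. -/
noncomputable def coinMass (A : Set V) : ℝ :=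
  ∏ w, if w ∈ A then 1 / 2 else 1

open Classical in
theorem coinMass_insert {A : Set V} {v : V} (hv : v ∉ A) :
    coinMass (insert v A) = 1 / 2 * coinMass A := by
  rw [coinMass, coinMass, ← Finset.mul_prod_erase _ _ (Finset.mem_univ v),
    ← Finset.mul_prod_erase _ (fun w => if w ∈ A then (1 / 2 : ℝ) else 1) (Finset.mem_univ v),
    if_pos (Set.mem_insert v A), if_neg hv, one_mul]
  congr 1
  refine Finset.prod_congr rfl fun w hw => ?_
  simp [Set.mem_insert_iff, Finset.ne_of_mem_erase hw]

theorem coinMass_ne_zero (A : Set V) : coinMass A ≠ 0 :=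
  Finset.prod_ne_zero_iff.2 fun w _ => by split_ifs <;> norm_num

end Coins

/-! ### Markov equivalence is equality of terminal sets -/

section Markov

variable [Fintype V] [DecidableEq V]

theorem marginal_pos {S : V → Type} [∀ v, Fintype (S v)] {p : (∀ v, S v) → ℝ}
    (hp : ∀ x, 0 < p x) (A : Set V) (x : ∀ v, S v) : 0 < marginal p A x :=
  Finset.sum_pos (fun y _ => hp y) ⟨x, by simp⟩

theorem prod_conditional_eq_of_hasTerminal_iff {S : V → Type} [∀ v, Fintype (S v)]
    {p : (∀ v, S v) → ℝ} (hp : ∀ x, 0 < p x) {G H : DAG V}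
    (h : ∀ C, HasTerminal G.Adj C ↔ HasTerminal H.Adj C) (x : ∀ v, S v) :
    ∏ v, conditional p v (G.parents v) x = ∏ v, conditional p v (H.parents v) x := by
  have hpos : ∀ A, marginal p A x ≠ 0 := fun A => (marginal_pos hp A x).ne'
  have hcpos : ∀ v A, 0 < conditional p v A x := fun v A =>
    div_pos (marginal_pos hp _ x) (marginal_pos hp _ x)
  apply Real.log_injOn_pos (Set.mem_Ioi.2 (Finset.prod_pos fun v _ => hcpos v _))
    (Set.mem_Ioi.2 (Finset.prod_pos fun v _ => hcpos v _))
  rw [Real.log_prod fun v _ => (hcpos v _).ne', Real.log_prod fun v _ => (hcpos v _).ne']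
  simp only [conditional, Real.log_div (hpos _) (hpos _)]
  exact sum_sub_eq_of_hasTerminal_iff (fun A => Real.log (marginal p A x)) h

/-- The distribution of fair signs whose only interaction is among all the variables in `C`. -/
noncomputable def parityDist (C : Finset V) (x : V → Bool) : ℝ :=
  ∏ _w : V, (1 / 2 : ℝ) + 1 / 2 * ∏ w, (1 / 2 * if w ∈ C then boolSign (x w) else 1)

theorem parityDist_eq (C : Finset V) (x : V → Bool) :
    parityDist C x = (∏ _w : V, (1 / 2 : ℝ)) * parityDensity C Set.univ x := by
  rw [parityDist, parityDensity, if_pos (Set.subset_univ _), Finset.prod_mul_distrib,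
    Finset.prod_ite_mem, Finset.univ_inter]
  ring

-- Both terms of `parityDist` are products over coordinates, so summing out the coordinates outside
-- `A` can be done factor by factor.
open Classical in
theorem marginal_parityDist (C : Finset V) (A : Set V) (x : V → Bool) :
    marginal (parityDist C) A x =
      coinMass A * parityDensity C A x := by
  have hset : (Finset.univ.filter fun y : V → Bool => ∀ w ∈ A, y w = x w) =
      Fintype.piFinset fun w => if w ∈ A then {x w} else Finset.univ := by
    ext y
    simp only [Finset.mem_filter, Finset.mem_univ, true_and, Fintype.mem_piFinset]
    refine forall_congr' fun w => ?_
    split_ifs with hw <;> simp [hw]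
  have hsum : ∀ f : V → Bool → ℝ,
      ∑ y ∈ Fintype.piFinset (fun w => if w ∈ A then {x w} else Finset.univ), ∏ w, f w (y w) =
        ∏ w, if w ∈ A then f w (x w) else f w true + f w false := by
    intro f
    rw [← Finset.prod_univ_sum]
    refine Finset.prod_congr rfl fun w _ => ?_
    split_ifs with hw <;> simp
  have hmarg : marginal (parityDist C) A x =
      ∑ y ∈ Fintype.piFinset (fun w => if w ∈ A then {x w} else Finset.univ),
        parityDist C y := by
    rw [← hset, marginal]
    congr!
  rw [hmarg]
  simp only [parityDist]
  rw [Finset.sum_add_distrib, ← Finset.mul_sum, hsum fun _ _ => 1 / 2,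
    hsum fun w b => 1 / 2 * if w ∈ C then boolSign b else 1, parityDensity, coinMass]
  have h₁ : (∏ w, if w ∈ A then (1 / 2 : ℝ) else 1 / 2 + 1 / 2) =
      ∏ w, if w ∈ A then (1 / 2 : ℝ) else 1 := by norm_num
  rw [h₁]
  by_cases hCA : (C : Set V) ⊆ A
  · rw [if_pos hCA, mul_add, mul_one, mul_left_comm]
    congr 2
    have h₂ : ∏ w ∈ C, boolSign (x w) = ∏ w, if w ∈ C then boolSign (x w) else 1 := by
      rw [Finset.prod_ite_mem, Finset.univ_inter]
    rw [h₂, ← Finset.prod_mul_distrib]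
    refine Finset.prod_congr rfl fun w _ => ?_
    by_cases hw : w ∈ A
    · simp [hw]
    · have : w ∉ C := fun h => hw (hCA h)
      rw [if_neg hw, if_neg hw, if_neg this, if_neg this, if_neg this]
      norm_num
  · rw [if_neg hCA, mul_one]
    obtain ⟨w, hwC, hwA⟩ := Set.not_subset.1 hCA
    rw [Finset.mem_coe] at hwC
    -- Summing out one sign in `C` kills the interaction.
    have h₂ : (∏ w, if w ∈ A then 1 / 2 * (if w ∈ C then boolSign (x w) else 1) else
        1 / 2 * (if w ∈ C then boolSign true else 1) +
          1 / 2 * (if w ∈ C then boolSign false else 1)) = 0 := by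
      refine Finset.prod_eq_zero (Finset.mem_univ w) ?_
      rw [if_neg hwA, if_pos hwC, if_pos hwC]
      simp [boolSign]
    rw [h₂, mul_zero, add_zero]

theorem isPositiveDistribution_parityDist {C : Finset V} (hC : C.Nonempty) :
    IsPositiveDistribution (S := fun _ => Bool) (parityDist C) := by
  classical
  constructor
  · intro x
    rw [parityDist_eq]
    exact mul_pos (Finset.prod_pos fun _ _ => by norm_num) (parityDensity_pos _ _ _)
  · have h := marginal_parityDist C ∅ fun _ => true
    have hC' : ¬ (C : Set V) ⊆ ∅ := by
      rw [Set.subset_empty_iff, Finset.coe_eq_empty]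
      exact hC.ne_empty
    rw [parityDensity, if_neg hC'] at h
    simpa [marginal, coinMass] using h

open Classical in
theorem conditional_parityDist (C : Finset V) {A : Set V} {v : V} (hv : v ∉ A) (x : V → Bool) :
    conditional (S := fun _ => Bool) (parityDist C) v A x =
      1 / 2 * if v ∈ C ∧ ∀ u ∈ C, u ≠ v → u ∈ A then parityDensity C Set.univ x else 1 := by
  have hq : parityDensity C (insert v A) x = parityDensity C A x *
      if v ∈ C ∧ ∀ u ∈ C, u ≠ v → u ∈ A then parityDensity C Set.univ x else 1 := by
    have h₁ := coe_subset_insert_iff C A v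
    have h₂ : (C : Set V) ⊆ A → v ∉ C := fun h h' => hv (h h')
    by_cases hA : (C : Set V) ⊆ A
    · rw [if_neg (fun h => h₂ hA h.1), mul_one, parityDensity, parityDensity,
        if_pos (h₁.2 (Or.inl hA)), if_pos hA]
    · rw [parityDensity, parityDensity, parityDensity, if_neg hA, one_mul,
        if_pos (Set.subset_univ _)]
      exact if_congr (h₁.trans (or_iff_right hA)) rfl rfl
  rw [conditional, marginal_parityDist, marginal_parityDist, coinMass_insert hv, hq,
    div_eq_iff (mul_ne_zero (coinMass_ne_zero A) (parityDensity_pos C A x).ne')]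
  ring

/-- Only a terminal vertex of `C` sees the interaction in its conditional; without one, the product
of conditionals is the uniform distribution. -/
theorem factorizes_parityDist_iff (G : DAG V) (C : Finset V) :
    Factorizes (S := fun _ => Bool) G (parityDist C) ↔ HasTerminal G.Adj C := by
  classical
  have hprod : ∀ x : V → Bool,
      ∏ v, conditional (S := fun _ => Bool) (parityDist C) v (G.parents v) x =
        (∏ _w : V, (1 / 2 : ℝ)) *
          if HasTerminal G.Adj C then parityDensity C Set.univ x else 1 := by
    intro x
    have hv : ∀ v, v ∉ G.parents v := G.irrefl
    simp only [conditional_parityDist C (hv _) x, Finset.prod_mul_distrib]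
    rw [← prod_ite_terminal G C]
    refine congrArg _ (Finset.prod_congr rfl fun v _ => ?_)
    by_cases h : v ∈ C ∧ ∀ u ∈ C, u ≠ v → G.Adj u v
    · exact (if_pos h).trans (if_pos h).symm
    · exact (if_neg h).trans (if_neg h).symm
  have h0 : (∏ _w : V, (1 / 2 : ℝ)) ≠ 0 := Finset.prod_ne_zero_iff.2 fun _ _ => by norm_num
  constructor
  · intro h
    by_contra hG
    -- At this point every sign is `1` and the density is `3/2`, not `1`.
    have hx := h fun _ => true
    rw [hprod, if_neg hG, parityDist_eq, mul_right_inj' h0, parityDensity,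
      if_pos (Set.subset_univ _)] at hx
    norm_num [boolSign] at hx
  · intro hG x
    rw [hprod, if_pos hG, parityDist_eq]

/-- DAGs are Markov equivalent if and only if they have the same terminal sets. -/
theorem markovEquivalent_iff_hasTerminal (G H : DAG V) :
    MarkovEquivalent G H ↔ ∀ C, HasTerminal G.Adj C ↔ HasTerminal H.Adj C := by
  constructor
  · intro h C
    -- For empty `C` the parity weights do not sum to `1`, but the empty set is never terminal.
    rcases C.eq_empty_or_nonempty with rfl | hC
    · simp [HasTerminal]
    · rw [← factorizes_parityDist_iff, ← factorizes_parityDist_iff]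
      exact h (fun _ => Bool) (parityDist C) (isPositiveDistribution_parityDist hC)
  · intro h S _ p hp
    exact forall_congr' fun x => by
      rw [prod_conditional_eq_of_hasTerminal_iff hp.1 h x]

end Markov

/-! ### The lower bound -/

section LowerBound

variable [Fintype V] [DecidableEq V]

/-- An atomic subset verifying set meets every chain component that contains a target edge. -/
theorem exists_singleton_mem_of_isSubsetVerifying {G : DAG V} {T : Set (V × V)}
    {𝓙 : Finset (Finset V)} (hatom : IsAtomic 𝓙) (hver : IsSubsetVerifying G T 𝓙)
    {𝓘 : Finset (Finset V)} {K : ChainComponent (essentialGraph G 𝓘)}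
    (hK : (K.edges ∩ {e | ∃ a ∈ T, e = s(a.1, a.2)}).Nonempty) :
    ∃ I ∈ 𝓙, ∃ w ∈ K.supp, I = {w} := by
  obtain ⟨_, ⟨hedge, hmem⟩, ⟨a, b⟩, haT, rfl⟩ := hK
  have ha : a ∈ K.supp := hmem a (by simp)
  have hb : b ∈ K.supp := hmem b (by simp)
  obtain ⟨-, -, D, hD, -, hba⟩ := (SimpleGraph.mem_edgeSet _).1 hedge
  have hDG := (markovEquivalent_iff_hasTerminal G D).1 hD.1
  have hGmem : G ∈ interventionalClass G 𝓘 :=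
    ⟨fun _ _ _ _ => Iff.rfl, fun _ _ _ _ _ => Iff.rfl⟩
  -- An edge on which `D` and `G` disagree is undirected in the essential graph, hence stays within
  -- one component.
  have hrev : ∀ u v, D.Adj u v → G.Adj v u → (u ∈ K.supp ↔ v ∈ K.supp) := by
    intro u v h₁ h₂
    have hadj : (essentialGraph G 𝓘).undirected.Adj u v := ⟨D, hD, G, hGmem, h₁, h₂⟩
    rw [SimpleGraph.ConnectedComponent.mem_supp_iff, SimpleGraph.ConnectedComponent.mem_supp_iff,
      SimpleGraph.ConnectedComponent.sound hadj.reachable]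
  have hcut : ∀ u v, ¬ (u ∈ K.supp ↔ v ∈ K.supp) → (D.Adj u v ↔ G.Adj u v) := by
    intro u v huv
    have hne : u ≠ v := fun e => huv (e ▸ Iff.rfl)
    have hskel := hDG {u, v}
    rw [hasTerminal_pair_iff hne, hasTerminal_pair_iff hne] at hskel
    constructor
    · intro h
      exact (hskel.2 (Or.inl h)).resolve_right fun h' => huv (hrev u v h h')
    · intro h
      exact (hskel.1 (Or.inl h)).resolve_right fun h' => huv (hrev v u h' h).symm
  by_contra hno
  push Not at hno
  have hDG' : ∀ C, HasTerminal D.Adj C ↔ HasTerminal G.Adj C := fun C => (hDG C).symm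
  have hsplice : splice hcut hDG' ∈ interventionalClass G 𝓙 := by
    refine ⟨(markovEquivalent_iff_hasTerminal _ _).2 fun C =>
      (hasTerminal_spliceAdj_iff hcut hDG' C).symm, ?_⟩
    intro I hI u v huv
    obtain ⟨w, rfl⟩ := Finset.card_eq_one.1 (hatom I hI)
    -- An edge cut by `{w}` has `w` as an endpoint; were it inside `K`, then `w` would lie in `K`.
    refine spliceAdj_of_notMem fun ⟨hu, hv⟩ => ?_
    rcases huv with ⟨h, -⟩ | ⟨-, h⟩ <;> obtain rfl := Finset.mem_singleton.1 h
    exacts [hno _ hI _ hu rfl, hno _ hI _ hv rfl]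
  have hab : D.Adj a b := (spliceAdj_of_mem hcut (Or.inl ha)).1 (hver haT _ hsplice)
  exact D.asymm hab hba

theorem numTargetComponents_le_card {G : DAG V} {T : Set (V × V)}
    {𝓙 : Finset (Finset V)} (hatom : IsAtomic 𝓙) (hver : IsSubsetVerifying G T 𝓙)
    (𝓘 : Finset (Finset V)) : numTargetComponents (essentialGraph G 𝓘) T ≤ 𝓙.card := by
  rw [← Set.ncard_coe_finset 𝓙]
  choose! I hI hI' using fun (K : ChainComponent (essentialGraph G 𝓘)) hK =>
    exists_singleton_mem_of_isSubsetVerifying hatom hver (K := K) hK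
  refine Set.ncard_le_ncard_of_injOn I (fun K hK => hI K hK) ?_ (Set.toFinite _)
  intro K hK L hL h
  obtain ⟨v, hv, hKv⟩ := hI' K hK
  obtain ⟨w, hw, hLw⟩ := hI' L hL
  obtain rfl : v = w := Finset.singleton_injective (hKv.symm.trans (h.trans hLw))
  rw [SimpleGraph.ConnectedComponent.mem_supp_iff] at hv hw
  exact hv.symm.trans hw

end LowerBound

end CausalDAG

theorem lemma2 {V : Type*} [Fintype V] [DecidableEq V] (G : CausalDAG.DAG V)
    (T : Set (V × V)) (hT : T ⊆ G.arcs) :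
    (Finset.univ : Finset (Finset (Finset V))).sup
        (fun 𝓘 => CausalDAG.numTargetComponents (CausalDAG.essentialGraph G 𝓘) T)
      ≤ CausalDAG.nuOne G T := by
  -- The infimum in `ℕ` is attained only over a nonempty set; over the empty set it would be the
  -- default value `0`.
  obtain ⟨𝓙₀, h₁, h₂⟩ := CausalDAG.exists_atomic_isSubsetVerifying G T hT
  obtain ⟨𝓙, hatom, hver, hcard⟩ := Nat.sInf_mem
    (s := {n | ∃ 𝓘 : Finset (Finset V), CausalDAG.IsAtomic 𝓘 ∧
      CausalDAG.IsSubsetVerifying G T 𝓘 ∧ 𝓘.card = n}) ⟨_, 𝓙₀, h₁, h₂, rfl⟩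
  refine Finset.sup_le fun 𝓘 _ => ?_
  exact (CausalDAG.numTargetComponents_le_card hatom hver 𝓘).trans hcard.le
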